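/- **Theorem.** Let $P=P_1|\dots|P_k$ be a network of processes of the asynchronous $\pi$-calculus $$P::=\mathbf 0\mid \bar x y\mid x(y).P\mid \nu x\,P\mid P|P\mid\ !P$$ with its early-instantiation transition system (with structural congruence generated by $\alpha$-conversion, commutativity and associativity of $|$, and scope extrusion). The countable set of names contains a special output channel $o$ and the natural numbers; the number $i\in\{1,\dots,k\}$ is the identifier of the process $P_i$. Let $H(P)=\langle N,X,t\rangle$ be the hypergraph with nodes $N=\{1,\dots,k\}$, arcs $X=\mathrm{fn}(P)\setminus\{o\}$ and $t(x)=\{n\mid x\in \mathrm{fn}(P_n)\}$. Suppose that $H(P)$ has an automorphism $\sigma=\langle\sigma_N,\sigma_X\rangle$ with $\sigma\neq \mathrm{id}=\langle \mathrm{id}_N,\mathrm{id}_X\rangle$ that generates only one orbit of nodes, and that $P$ is symmetric with respect to $\sigma$, i.e. $P_{\sigma_N(i)}\equiv_\alpha\sigma(P_i)$ for each $i\in N$. Here $\sigma(Q)$ is obtained by renaming the free names of $Q$ without capture: an identifier $n\in\{1,\dots,k\}$ becomes $\sigma_N(n)$, any other name $x\in X$ becomes $\sigma_X(x)$, and $o$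 is fixed. Then $P$ is not an electoral system. Here a computation of $P$ is a finite or infinite sequence of transitions of the network, which may be silent or visible; each transition is an action of a single component or a communication between two of them. When a communication transmits a private name, its binder is moved to the top level, and no visible action is performed on a name that is restricted there (sending such a name to the environment is a bound output and removes the restriction). The projection of a computation over $P_i$ is the sequence of actions that $P_i$ contributes, either alone or as a partner in a communication. $P$ is an *electoral system* if for every computation $C$ of $P$ there are an extension $C'$ of $C$ ($C'=C$ allowed; an infinite $C$ extends only to itself) and an $n\in\{1,\dots,k\}$ such that for each $i\in\{1,\dots,k\}$ the projection of $C'$ over $P_i$ contains an output action $\bar o n$, and no extension of $C'$ contains an action $\bar o m$ with $m\neq n$. -/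

import Mathlib

namespace PiA

/-! ### Names, processes, actions -/

/-- The countable set of names.  It contains the external output channel `o`, the natural numbers
(`num n`), which serve as process identifiers, and infinitely many other names. -/
inductive Name : Type
  | o : Name
  | num (n : ℕ) : Name
  | chan (n : ℕ) : Name
  deriving DecidableEq

/-- Processes of the asynchronous pi-calculus (raw terms, with named binders):
inaction, output action, input prefix, restriction, parallel composition, replication.
`input x y P` binds `y` in `P` and `nu x P` binds `x` in `P`. -/
inductive Proc : Type
  | nil : Proc
  | output (x y : Name) : Proc
  | input (x y : Name) (P : Proc) : Proc
  | nu (x : Name) (P : Proc) : Proc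
  | par (P Q : Proc) : Proc
  | bang (P : Proc) : Proc

namespace Proc

/-- Free names. -/
def fn : Proc → Finset Name
  | nil => ∅
  | output x y => {x, y}
  | input x y P => insert x (P.fn.erase y)
  | nu x P => P.fn.erase x
  | par P Q => P.fn ∪ Q.fn
  | bang P => P.fn

/-- Names that occur in binding position. -/
def bv : Proc → Finset Name
  | nil => ∅
  | output _ _ => ∅
  | input _ y P => insert y P.bv
  | nu x P => insert x P.bv
  | par P Q => P.bv ∪ Q.bv
  | bang P => P.bv

/-- Apply `f` to all occurrences of names, the binding ones included. -/
def map (f : Name → Name) : Proc → Proc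
  | nil => nil
  | output x y => output (f x) (f y)
  | input x y P => input (f x) (f y) (P.map f)
  | nu x P => nu (f x) (P.map f)
  | par P Q => par (P.map f) (Q.map f)
  | bang P => bang (P.map f)

/-- `P.subst y z` replaces the free occurrences of `y` in `P` by `z`.  It is the substitution
`P{z/y}` provided that `z` is not bound in `P`; it is only used under that side condition, which
can always be reached by alpha-conversion. -/
def subst (y z : Name) : Proc → Proc
  | nil => nil
  | output a b => output (if a = y then z else a) (if b = y then z else b)
  | input a w P => input (if a = y then z else a) w (if w = y then P else P.subst y z)
  | nu w P => nu w (if w = y then P else P.subst y z)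
  | par P Q => par (P.subst y z) (Q.subst y z)
  | bang P => bang (P.subst y z)

end Proc

/-- Alpha-equivalence: the least congruence that allows to rename a binder `x` to any name `y` not
free in its scope (exchanging `x` and `y` in the whole scope, so that nothing is captured). -/
inductive AlphaEq : Proc → Proc → Prop
  | refl (P : Proc) : AlphaEq P P
  | symm {P Q : Proc} : AlphaEq P Q → AlphaEq Q P
  | trans {P Q R : Proc} : AlphaEq P Q → AlphaEq Q R → AlphaEq P R
  | renameInput (x : Name) {y z : Name} {P : Proc} : z ∉ P.fn →
      AlphaEq (.input x y P) (.input x z (P.map (Equiv.swap y z)))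
  | renameNu {y z : Name} {P : Proc} : z ∉ P.fn →
      AlphaEq (.nu y P) (.nu z (P.map (Equiv.swap y z)))
  | input (x y : Name) {P P' : Proc} : AlphaEq P P' → AlphaEq (.input x y P) (.input x y P')
  | nu (x : Name) {P P' : Proc} : AlphaEq P P' → AlphaEq (.nu x P) (.nu x P')
  | par {P P' Q Q' : Proc} : AlphaEq P P' → AlphaEq Q Q' → AlphaEq (.par P Q) (.par P' Q')
  | bang {P P' : Proc} : AlphaEq P P' → AlphaEq (.bang P) (.bang P')

/-- Structural congruence: the least congruence containing alpha-equivalence, commutativity and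
associativity of parallel composition, and scope extrusion. -/
inductive Struct : Proc → Proc → Prop
  | alpha {P Q : Proc} : AlphaEq P Q → Struct P Q
  | symm {P Q : Proc} : Struct P Q → Struct Q P
  | trans {P Q R : Proc} : Struct P Q → Struct Q R → Struct P R
  | parComm (P Q : Proc) : Struct (.par P Q) (.par Q P)
  | parAssoc (P Q R : Proc) : Struct (.par (.par P Q) R) (.par P (.par Q R))
  | scope {x : Name} (P : Proc) {Q : Proc} : x ∉ Q.fn →
      Struct (.par (.nu x P) Q) (.nu x (.par P Q))
  | input (x y : Name) {P P' : Proc} : Struct P P' → Struct (.input x y P) (.input x y P')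
  | nu (x : Name) {P P' : Proc} : Struct P P' → Struct (.nu x P) (.nu x P')
  | par {P P' Q Q' : Proc} : Struct P P' → Struct Q Q' → Struct (.par P Q) (.par P' Q')
  | bang {P P' : Proc} : Struct P P' → Struct (.bang P) (.bang P')

/-- Actions: silent, input `x(y)`, free output, bound output. -/
inductive Act : Type
  | tau : Act
  | inp (x y : Name) : Act
  | out (x y : Name) : Act
  | bout (x y : Name) : Act

namespace Act

/-- All names of an action. -/
def names : Act → Finset Name
  | tau => ∅
  | inp x y => {x, y}
  | out x y => {x, y}
  | bout x y => {x, y}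

/-- Names which an action introduces as new ones, and which must therefore not be confused with the
free names of a parallel process.  As usual in the early semantics, the name received by an input
is an arbitrary one, so that only the object of a bound output is in question. -/
def bn : Act → Finset Name
  | bout _ y => {y}
  | _ => ∅

end Act

/-- The early-instantiation transition system of the asynchronous pi-calculus. -/
inductive Step : Proc → Act → Proc → Prop
  | out (x y : Name) : Step (.output x y) (.out x y) .nil
  | inp (x y : Name) {z : Name} {P : Proc} : z ∉ P.bv →
      Step (.input x y P) (.inp x z) (P.subst y z)
  | opn {x y : Name} {P P' : Proc} : x ≠ y → Step P (.out x y) P' →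
      Step (.nu y P) (.bout x y) P'
  | res {y : Name} {μ : Act} {P P' : Proc} : y ∉ μ.names → Step P μ P' →
      Step (.nu y P) μ (.nu y P')
  | par {μ : Act} {P P' : Proc} (Q : Proc) : Disjoint μ.bn Q.fn → Step P μ P' →
      Step (.par P Q) μ (.par P' Q)
  | com {x y : Name} {P P' Q Q' : Proc} : Step P (.inp x y) P' → Step Q (.out x y) Q' →
      Step (.par P Q) .tau (.par P' Q')
  | close {x y : Name} {P P' Q Q' : Proc} : y ∉ P.fn →
      Step P (.inp x y) P' → Step Q (.bout x y) Q' →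
      Step (.par P Q) .tau (.nu y (.par P' Q'))
  | rep {μ : Act} {P P' : Proc} : Step (.par P (.bang P)) μ P' → Step (.bang P) μ P'
  | cong {μ : Act} {P P' Q Q' : Proc} : Struct P P' → Step P' μ Q' → Struct Q' Q →
      Step P μ Q

/-! ### Hypergraphs and their automorphisms -/

/-- A hypergraph with node set `N` and arc set `X`; `type x` is the set of nodes connected by the
arc `x`. -/
structure Hypergraph (N X : Type) [Finite N] [Finite X] where
  type : X → Set N

/-- Automorphisms: pairs of permutations of the nodes and of the arcs that preserve the type. -/
structure Hypergraph.Aut {N X : Type} [Finite N] [Finite X] (H : Hypergraph N X) where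
  nodes : Equiv.Perm N
  arcs : Equiv.Perm X
  type_arcs : ∀ x, H.type (arcs x) = nodes '' H.type x

/-- The identity automorphism: the pair of the identities on nodes and on arcs. -/
def Hypergraph.Aut.id {N X : Type} [Finite N] [Finite X] (H : Hypergraph N X) : H.Aut where
  nodes := 1
  arcs := 1
  type_arcs := by simp

/-- The orbit of the node `n` generated by `σ`. -/
def Hypergraph.Aut.orbit {N X : Type} [Finite N] [Finite X] {H : Hypergraph N X} (σ : H.Aut)
    (n : N) : Set N :=
  {m | ∃ j : ℕ, (σ.nodes ^ j) n = m}

/-- `σ` generates exactly one orbit. -/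
def Hypergraph.Aut.HasOneOrbit {N X : Type} [Finite N] [Finite X] {H : Hypergraph N X}
    (σ : H.Aut) : Prop :=
  ∃! O : Set N, ∃ n : N, O = σ.orbit n

/-! ### Networks, their hypergraphs, symmetry

A network `P_1 | ... | P_k` is a family `P : Fin k → Proc`; the element `i` of `Fin k` stands for
the node `i + 1`. -/

/-- The natural number that identifies a node, as a name. -/
def nodeName {k : ℕ} (i : Fin k) : Name := .num (i + 1)

/-- The node identified by a name, if there is one. -/
def nodeOf (k : ℕ) : Name → Option (Fin k)
  | .num (n + 1) => if h : n < k then some ⟨n, h⟩ else none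
  | _ => none

/-- The arcs of the hypergraph of a network: its free names other than `o`. -/
def netArcs {k : ℕ} (P : Fin k → Proc) : Finset Name :=
  (Finset.univ.biUnion fun i => (P i).fn).erase .o

/-- The hypergraph associated to a network. -/
def netHypergraph {k : ℕ} (P : Fin k → Proc) : Hypergraph (Fin k) {x // x ∈ netArcs P} where
  type x := {i | x.1 ∈ (P i).fn}

/-- The action of `σ` on names: node identifiers are moved by `σ` as nodes, all the other free names
except `o` are moved by `σ` as arcs, and everything else is fixed. -/
def renameName {k : ℕ} {P : Fin k → Proc} (σ : (netHypergraph P).Aut) (x : Name) : Name :=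
  match nodeOf k x with
  | some i => nodeName (σ.nodes i)
  | none => if h : x ∈ netArcs P then (σ.arcs ⟨x, h⟩).1 else x

/-- `Q'` is the `σ`-renaming of `Q`: alpha-convert `Q` so that all bound names are new (not arcs,
not `o`, not node identifiers, hence fixed by `σ`), then apply `σ` homomorphically. -/
def IsRenaming {k : ℕ} {P : Fin k → Proc} (σ : (netHypergraph P).Aut) (Q Q' : Proc) : Prop :=
  ∃ Q₀ : Proc, AlphaEq Q Q₀ ∧
    (∀ x ∈ Q₀.bv, x ∉ netArcs P ∧ x ≠ .o ∧ nodeOf k x = none) ∧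
    AlphaEq (Q₀.map (renameName σ)) Q'

/-- The network `P` is symmetric with respect to `σ`. -/
def SymmetricWrt {k : ℕ} (P : Fin k → Proc) (σ : (netHypergraph P).Aut) : Prop :=
  ∀ i, IsRenaming σ (P i) (P (σ.nodes i))

/-! ### Computations of a network -/

/-- A state of a network: the components, and the names restricted by the binders that have been
pushed to the top level. -/
structure NetState (k : ℕ) where
  hidden : Finset Name
  comp : Fin k → Proc

/-- `y` may be chosen as a new name in the state `S`. -/
def NetState.IsFresh {k : ℕ} (S : NetState k) (y : Name) : Prop :=
  y ≠ .o ∧ nodeOf k y = none ∧ y ∉ S.hidden ∧ ∀ i, y ∉ (S.comp i).fn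

/-- Transitions of a network.  `NetStep S μ c S'` means that the network has a transition with
label `μ` from `S` to `S'` in which the component `i` takes part with the action `a` if
`c i = some a`, and is idle if `c i = none`. The components act alone (`tau` to `bout`) or two of
them communicate (`com`, `close`).  No visible action takes place on a hidden name; in `opn` a
hidden name is sent to the environment, which removes its binder. -/
inductive NetStep {k : ℕ} : NetState k → Act → (Fin k → Option Act) → NetState k → Prop
  | tau {S : NetState k} {i : Fin k} {P' : Proc} : Step (S.comp i) .tau P' →
      NetStep S .tau (Function.update (fun _ => none) i (some .tau))
        ⟨S.hidden, Function.update S.comp i P'⟩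
  | inp {S : NetState k} {i : Fin k} {x y : Name} {P' : Proc} : Step (S.comp i) (.inp x y) P' →
      x ∉ S.hidden → y ∉ S.hidden →
      NetStep S (.inp x y) (Function.update (fun _ => none) i (some (.inp x y)))
        ⟨S.hidden, Function.update S.comp i P'⟩
  | out {S : NetState k} {i : Fin k} {x y : Name} {P' : Proc} : Step (S.comp i) (.out x y) P' →
      x ∉ S.hidden → y ∉ S.hidden →
      NetStep S (.out x y) (Function.update (fun _ => none) i (some (.out x y)))
        ⟨S.hidden, Function.update S.comp i P'⟩
  | opn {S : NetState k} {i : Fin k} {x y : Name} {P' : Proc} : Step (S.comp i) (.out x y) P' →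
      x ∉ S.hidden → y ∈ S.hidden →
      NetStep S (.bout x y) (Function.update (fun _ => none) i (some (.out x y)))
        ⟨S.hidden.erase y, Function.update S.comp i P'⟩
  | bout {S : NetState k} {i : Fin k} {x y : Name} {P' : Proc} : Step (S.comp i) (.bout x y) P' →
      x ∉ S.hidden → S.IsFresh y →
      NetStep S (.bout x y) (Function.update (fun _ => none) i (some (.bout x y)))
        ⟨S.hidden, Function.update S.comp i P'⟩
  | com {S : NetState k} {i j : Fin k} {x y : Name} {P' Q' : Proc} : i ≠ j →
      Step (S.comp i) (.inp x y) P' → Step (S.comp j) (.out x y) Q' →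
      NetStep S .tau
        (Function.update (Function.update (fun _ => none) i (some (.inp x y))) j
          (some (.out x y)))
        ⟨S.hidden, Function.update (Function.update S.comp i P') j Q'⟩
  | close {S : NetState k} {i j : Fin k} {x y : Name} {P' Q' : Proc} : i ≠ j → S.IsFresh y →
      Step (S.comp i) (.inp x y) P' → Step (S.comp j) (.bout x y) Q' →
      NetStep S .tau
        (Function.update (Function.update (fun _ => none) i (some (.inp x y))) j
          (some (.bout x y)))
        ⟨insert y S.hidden, Function.update (Function.update S.comp i P') j Q'⟩

/-- A computation of the network `P`: a finite or infinite sequence of `length` transitions, the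
`m`-th one leading from `state m` to `state (m + 1)` with label `act m` and contributions
`contrib m`.  The values beyond `length` have no meaning. -/
structure Computation {k : ℕ} (P : Fin k → Proc) where
  length : ℕ∞
  state : ℕ → NetState k
  act : ℕ → Act
  contrib : ℕ → Fin k → Option Act
  init : state 0 = ⟨∅, P⟩
  step : ∀ m : ℕ, (m : ℕ∞) < length → NetStep (state m) (act m) (contrib m) (state (m + 1))

namespace Computation

variable {k : ℕ} {P : Fin k → Proc}

/-- `C'` extends `C`. -/
def Extends (C C' : Computation P) : Prop :=
  C.length ≤ C'.length ∧
    (∀ m : ℕ, (m : ℕ∞) ≤ C.length → C'.state m = C.state m) ∧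
    ∀ m : ℕ, (m : ℕ∞) < C.length → C'.act m = C.act m ∧ C'.contrib m = C.contrib m

/-- The action `a` occurs in the computation `C`. -/
def Contains (C : Computation P) (a : Act) : Prop :=
  ∃ m : ℕ, (m : ℕ∞) < C.length ∧ C.act m = a

/-- The action `a` occurs in the projection of `C` over the component `i`. -/
def ProjContains (C : Computation P) (i : Fin k) (a : Act) : Prop :=
  ∃ m : ℕ, (m : ℕ∞) < C.length ∧ C.contrib m i = some a

end Computation

/-- Electoral systems: every computation has an extension `C'` in which every component outputs, on
the channel `o`, the identifier of the same node `n`, the leader, while no extension of `C'`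
contains an output of a different name on `o`. -/
def IsElectoral {k : ℕ} (P : Fin k → Proc) : Prop :=
  ∀ C : Computation P, ∃ C' : Computation P, C.Extends C' ∧ ∃ n : Fin k,
    (∀ i, C'.ProjContains i (.out .o (nodeName n))) ∧
    ∀ C'' : Computation P, C'.Extends C'' →
      ∀ m : Name, m ≠ nodeName n → ¬ C''.Contains (.out .o m)

end PiA

namespace PiA

/-! ### Renaming by injective maps -/

namespace Proc

/-! Suppose the network is electoral. A symmetric scheduler builds an infinite computation that
never declares a leader, a contradiction.

The automorphism is first turned into a permutation of all names whose `k`-th power is the identity.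
Alpha-equivalence preserves not just the set but the ordered list `occ` of free occurrences. Going
once around the cycle of nodes therefore returns each component with the same list, so the `k`-fold
renaming fixes every free name (`SymmetricWrt.renameName_iterate`). The same argument with one node
makes the automorphism trivial, so `2 ≤ k`. The permutation also cycles through unused names, which
supply fresh private names symmetrically (`SymmetricWrt.exists_netSymmetry`).

The computation runs in rounds of `k` solo transitions, always without hidden names. In a symmetric
undecided state some transition exists, since otherwise no leader could ever be declared; hence some
component `j` can act alone (`NetStep.exists_solo`). By equivariance (`Step.map`) the other nodes
imitate it one after another along the cycle, and symmetry returns after `k` moves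
(`preserves_advance`). If the move of `j` named a leader `n`, the next node could at once name the
image of `n`, a different node because the cycle has length at least two; this is forbidden. So
rounds continue forever without a declaration, against `IsElectoral.not_invariant`. -/

theorem map_map (f g : Name → Name) (P : Proc) : (P.map f).map g = P.map (g ∘ f) := by
  induction P <;> simp_all [map]

theorem map_id (P : Proc) : P.map _root_.id = P := by
  induction P <;> simp_all [map]

/-- No injectivity is assumed: the result also compares with `renameName`, which is not known to be
injective in advance. -/
theorem map_congr {f g : Name → Name} {P : Proc} (hfn : ∀ x ∈ P.fn, f x = g x)
    (hbv : ∀ x ∈ P.bv, f x = g x) : P.map f = P.map g := by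
  induction P with
  | nil => rfl
  | output x y => simp_all [map, fn]
  | input x y P ih =>
    simp only [fn, bv, Finset.mem_insert, Finset.mem_erase, forall_eq_or_imp] at hfn hbv
    simp only [map, hfn.1, hbv.1, input.injEq, true_and]
    refine ih (fun z hz => ?_) hbv.2
    by_cases h : z = y
    · rw [h, hbv.1]
    · exact hfn.2 z ⟨h, hz⟩
  | nu x P ih =>
    simp only [fn, bv, Finset.mem_insert, Finset.mem_erase, forall_eq_or_imp] at hfn hbv
    simp only [map, hbv.1, nu.injEq, true_and]
    refine ih (fun z hz => ?_) hbv.2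
    by_cases h : z = x
    · rw [h, hbv.1]
    · exact hfn z ⟨h, hz⟩
  | par P Q ihP ihQ =>
    simp only [fn, bv, Finset.mem_union] at hfn hbv
    rw [map, map, ihP (fun x h => hfn x (.inl h)) fun x h => hbv x (.inl h),
      ihQ (fun x h => hfn x (.inr h)) fun x h => hbv x (.inr h)]
  | bang P ih => rw [map, map, ih hfn hbv]

theorem fn_map {f : Name → Name} (hf : f.Injective) (P : Proc) :
    (P.map f).fn = P.fn.image f := by
  induction P <;> simp_all [map, fn, Finset.image_insert, Finset.image_erase, Finset.image_union]

theorem bv_map (f : Name → Name) (P : Proc) : (P.map f).bv = P.bv.image f := by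
  induction P <;> simp_all [map, bv, Finset.image_insert, Finset.image_union]

theorem notMem_fn_map {f : Name → Name} (hf : f.Injective) {P : Proc} {x : Name} (h : x ∉ P.fn) :
    f x ∉ (P.map f).fn := by
  rwa [fn_map hf, hf.mem_finset_image]

theorem map_subst {f : Name → Name} (hf : f.Injective) (y z : Name) (P : Proc) :
    (P.subst y z).map f = (P.map f).subst (f y) (f z) := by
  induction P with
  | nil => rfl
  | output a b => simp only [subst, map, hf.eq_iff, apply_ite f]
  | input a w P ih =>
    simp only [subst, map, hf.eq_iff, apply_ite f, apply_ite (map f), ih]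
  | nu w P ih => simp only [subst, map, hf.eq_iff, apply_ite (map f), ih]
  | par P Q ihP ihQ => simp only [subst, map, ihP, ihQ]
  | bang P ih => simp only [subst, map, ih]

theorem map_map_swap {f : Name → Name} (hf : f.Injective) (y z : Name) (P : Proc) :
    (P.map (Equiv.swap y z)).map f = (P.map f).map (Equiv.swap (f y) (f z)) := by
  rw [map_map, map_map]
  congr 1
  funext x
  exact hf.map_swap ..

theorem fn_subst_subset (y z : Name) (P : Proc) :
    (P.subst y z).fn ⊆ insert z (P.fn.erase y) := by
  induction P with
  | nil => simp [subst, fn]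
  | output a b =>
    intro x
    simp only [subst, fn, Finset.mem_insert, Finset.mem_singleton, Finset.mem_erase]
    grind
  | input a w P ih =>
    intro x
    have := @ih x
    simp only [subst, fn, Finset.mem_insert, Finset.mem_erase] at this ⊢
    grind
  | nu w P ih =>
    intro x
    have := @ih x
    simp only [subst, fn, Finset.mem_insert, Finset.mem_erase] at this ⊢
    grind
  | par P Q ihP ihQ =>
    intro x
    have h₁ := @ihP x
    have h₂ := @ihQ x
    simp only [subst, fn, Finset.mem_insert, Finset.mem_erase, Finset.mem_union] at h₁ h₂ ⊢
    grind
  | bang P ih => exact ih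

/-- The list of the free occurrences of names. -/
def occ : Proc → List Name
  | nil => []
  | output x y => [x, y]
  | input x y P => x :: P.occ.filter (· ≠ y)
  | nu x P => P.occ.filter (· ≠ x)
  | par P Q => P.occ ++ Q.occ
  | bang P => P.occ

theorem mem_occ {P : Proc} {x : Name} : x ∈ P.occ ↔ x ∈ P.fn := by
  induction P <;> simp_all [occ, fn, and_comm]

/-- A renaming that respects the bound names acts on the free occurrences. -/
theorem occ_map {f : Name → Name} {P : Proc} (h : ∀ y ∈ P.bv, ∀ x, f x = y ↔ x = y) :
    (P.map f).occ = P.occ.map f := by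
  induction P with
  | nil => rfl
  | output x y => rfl
  | input x y P ih =>
    simp only [bv, Finset.mem_insert, forall_eq_or_imp] at h
    have hy : f y = y := (h.1 y).2 rfl
    simp only [map, occ, ih h.2, List.filter_map, List.map_cons, hy]
    congr 3
    funext v
    simp [h.1 v]
  | nu y P ih =>
    simp only [bv, Finset.mem_insert, forall_eq_or_imp] at h
    have hy : f y = y := (h.1 y).2 rfl
    simp only [map, occ, ih h.2, List.filter_map, hy]
    congr 2
    funext v
    simp [h.1 v]
  | par P Q ihP ihQ =>
    simp only [bv, Finset.mem_union] at h
    simp only [map, occ, ihP fun y hy => h y (.inl hy), ihQ fun y hy => h y (.inr hy),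
      List.map_append]
  | bang P ih => exact ih h

theorem occ_map_of_injective {f : Name → Name} (hf : f.Injective) (P : Proc) :
    (P.map f).occ = P.occ.map f := by
  induction P with
  | nil => rfl
  | output x y => rfl
  | input x y P ih =>
    simp only [map, occ, ih, List.filter_map, List.map_cons]
    congr 3
    funext v
    simp [hf.eq_iff]
  | nu y P ih =>
    simp only [map, occ, ih, List.filter_map]
    congr 2
    funext v
    simp [hf.eq_iff]
  | par P Q ihP ihQ => simp only [map, occ, ihP, ihQ, List.map_append]
  | bang P ih => exact ih

/-- The swap carries the occurrences of `y` to `z` and, as `z` is not free, moves nothing else. This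
makes `occ` insensitive to the choice of a binder. -/
theorem filter_occ_map_swap {y z : Name} {P : Proc} (hz : z ∉ P.fn) :
    (P.map (Equiv.swap y z)).occ.filter (· ≠ z) = P.occ.filter (· ≠ y) := by
  rw [occ_map_of_injective (Equiv.injective _), List.filter_map]
  have h : (fun v => decide (v ≠ z)) ∘ Equiv.swap y z = fun v => decide (v ≠ y) := by
    funext v
    simp [Equiv.swap_apply_eq_iff]
  rw [h]
  refine (List.map_congr_left fun v hv => ?_).trans (List.map_id _)
  simp only [List.mem_filter, mem_occ, decide_eq_true_eq] at hv
  exact Equiv.swap_apply_of_ne_of_ne hv.2 fun e => hz (e ▸ hv.1)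

end Proc

/-! ### Equivariance of the transition system -/

theorem AlphaEq.occ_eq {P Q : Proc} (h : AlphaEq P Q) : P.occ = Q.occ := by
  induction h with
  | refl => rfl
  | symm _ ih => exact ih.symm
  | trans _ _ ih₁ ih₂ => exact ih₁.trans ih₂
  | renameInput x hz => simp only [Proc.occ, Proc.filter_occ_map_swap hz]
  | renameNu hz => simp only [Proc.occ, Proc.filter_occ_map_swap hz]
  | input _ _ _ ih => simp only [Proc.occ, ih]
  | nu _ _ ih => simp only [Proc.occ, ih]
  | par _ _ ih₁ ih₂ => simp only [Proc.occ, ih₁, ih₂]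
  | bang _ ih => exact ih

theorem AlphaEq.fn_eq {P Q : Proc} (h : AlphaEq P Q) : P.fn = Q.fn := by
  ext x
  rw [← Proc.mem_occ, h.occ_eq, Proc.mem_occ]

theorem AlphaEq.map {f : Name → Name} (hf : f.Injective) {P Q : Proc} (h : AlphaEq P Q) :
    AlphaEq (P.map f) (Q.map f) := by
  induction h with
  | refl => exact .refl _
  | symm _ ih => exact ih.symm
  | trans _ _ ih₁ ih₂ => exact ih₁.trans ih₂
  | renameInput x hz =>
    simp only [Proc.map, Proc.map_map_swap hf]
    exact .renameInput _ (Proc.notMem_fn_map hf hz)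
  | renameNu hz =>
    simp only [Proc.map, Proc.map_map_swap hf]
    exact .renameNu (Proc.notMem_fn_map hf hz)
  | input _ _ _ ih => exact .input _ _ ih
  | nu _ _ ih => exact .nu _ ih
  | par _ _ ih₁ ih₂ => exact .par ih₁ ih₂
  | bang _ ih => exact .bang ih

theorem Struct.fn_eq {P Q : Proc} (h : Struct P Q) : P.fn = Q.fn := by
  induction h with
  | alpha h => exact h.fn_eq
  | symm _ ih => exact ih.symm
  | trans _ _ ih₁ ih₂ => exact ih₁.trans ih₂
  | parComm => exact Finset.union_comm _ _
  | parAssoc => exact Finset.union_assoc _ _ _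
  | scope P hx =>
    simp only [Proc.fn, Finset.erase_union_distrib, Finset.erase_eq_of_notMem hx]
  | input _ _ _ ih => simp only [Proc.fn, ih]
  | nu _ _ ih => simp only [Proc.fn, ih]
  | par _ _ ih₁ ih₂ => simp only [Proc.fn, ih₁, ih₂]
  | bang _ ih => exact ih

theorem Struct.map {f : Name → Name} (hf : f.Injective) {P Q : Proc} (h : Struct P Q) :
    Struct (P.map f) (Q.map f) := by
  induction h with
  | alpha h => exact .alpha (h.map hf)
  | symm _ ih => exact ih.symm
  | trans _ _ ih₁ ih₂ => exact ih₁.trans ih₂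
  | parComm => exact .parComm _ _
  | parAssoc => exact .parAssoc _ _ _
  | scope P hx => exact .scope _ (Proc.notMem_fn_map hf hx)
  | input _ _ _ ih => exact .input _ _ ih
  | nu _ _ ih => exact .nu _ ih
  | par _ _ ih₁ ih₂ => exact .par ih₁ ih₂
  | bang _ ih => exact .bang ih

/-- Renamings that agree on the free names of a process lead to alpha-equivalent processes. -/
theorem AlphaEq.map_of_eqOn {f g : Name → Name} (hf : f.Injective) (hg : g.Injective) {P : Proc}
    (h : ∀ x ∈ P.fn, f x = g x) : AlphaEq (P.map f) (P.map g) := by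
  -- When `f` and `g` disagree on a binder `w`, it is renamed from `f w` to `g w`. Correcting `f` by
  -- this swap keeps it injective and makes it agree with `g` on the whole scope, which is why the
  -- induction generalizes over `f`.
  have key : ∀ {f : Name → Name} {w : Name} {P : Proc}, f.Injective →
      (∀ x ∈ P.fn.erase w, f x = g x) → f w ≠ g w →
      g w ∉ (P.map f).fn ∧ ∀ x ∈ P.fn, (Equiv.swap (f w) (g w) ∘ f) x = g x := by
    intro f w P hf h hw
    refine ⟨fun hmem => ?_, fun x hx => ?_⟩
    · rw [Proc.fn_map hf, Finset.mem_image] at hmem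
      obtain ⟨v, hv, e⟩ := hmem
      have hvw : v ≠ w := fun e' => hw (e' ▸ e)
      rw [h v (Finset.mem_erase.2 ⟨hvw, hv⟩)] at e
      exact hvw (hg e)
    · by_cases hxw : x = w
      · simp [hxw]
      · have e := h x (Finset.mem_erase.2 ⟨hxw, hx⟩)
        rw [Function.comp_apply, Equiv.swap_apply_of_ne_of_ne (hf.ne hxw) (e ▸ hg.ne hxw), e]
  have full : ∀ {f : Name → Name} {w : Name} {P : Proc},
      (∀ x ∈ P.fn.erase w, f x = g x) → f w = g w → ∀ x ∈ P.fn, f x = g x := by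
    intro f w P h hw x hx
    by_cases hxw : x = w
    · rw [hxw, hw]
    · exact h x (Finset.mem_erase.2 ⟨hxw, hx⟩)
  induction P generalizing f with
  | nil => exact .refl _
  | output x y =>
    simp only [Proc.fn, Finset.mem_insert, Finset.mem_singleton, forall_eq_or_imp, forall_eq] at h
    simp only [Proc.map, h.1, h.2]
    exact .refl _
  | input x w P ih =>
    simp only [Proc.fn, Finset.mem_insert, forall_eq_or_imp] at h
    simp only [Proc.map, h.1]
    by_cases hw : f w = g w
    · rw [hw]
      exact .input _ _ (ih hf (full h.2 hw))
    · obtain ⟨h₁, h₂⟩ := key hf h.2 hw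
      refine (AlphaEq.renameInput _ h₁).trans (.input _ _ ?_)
      rw [Proc.map_map]
      exact ih ((Equiv.injective _).comp hf) h₂
  | nu w P ih =>
    simp only [Proc.fn] at h
    simp only [Proc.map]
    by_cases hw : f w = g w
    · rw [hw]
      exact .nu _ (ih hf (full h hw))
    · obtain ⟨h₁, h₂⟩ := key hf h hw
      refine (AlphaEq.renameNu h₁).trans (.nu _ ?_)
      rw [Proc.map_map]
      exact ih ((Equiv.injective _).comp hf) h₂
  | par P Q ihP ihQ =>
    simp only [Proc.fn, Finset.mem_union] at h
    exact .par (ihP hf fun x hx => h x (.inl hx)) (ihQ hf fun x hx => h x (.inr hx))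
  | bang P ih => exact .bang (ih hf h)

namespace Act

/-- Apply `f` to all names of an action. -/
def map (f : Name → Name) : Act → Act
  | tau => tau
  | inp x y => inp (f x) (f y)
  | out x y => out (f x) (f y)
  | bout x y => bout (f x) (f y)

/-- Names that the target of a transition may have in addition to those of the source. -/
def acquired : Act → Finset Name
  | inp _ y => {y}
  | bout _ y => {y}
  | _ => ∅

theorem names_map (f : Name → Name) (a : Act) : (a.map f).names = a.names.image f := by
  cases a <;> simp [map, names, Finset.image_insert]

theorem bn_map (f : Name → Name) (a : Act) : (a.map f).bn = a.bn.image f := by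
  cases a <;> simp [map, bn]

end Act

theorem Step.map {f : Name → Name} (hf : f.Injective) {P Q : Proc} {a : Act} (h : Step P a Q) :
    Step (P.map f) (a.map f) (Q.map f) := by
  induction h with
  | out x y => exact .out _ _
  | inp x y hz =>
    rw [Proc.map_subst hf]
    exact .inp _ _ (by rwa [Proc.bv_map, hf.mem_finset_image])
  | opn hxy _ ih => exact .opn (hf.ne hxy) ih
  | res hy _ ih =>
    exact .res (by rwa [Act.names_map, hf.mem_finset_image]) ih
  | par Q hd _ ih =>
    exact .par _ (by rwa [Act.bn_map, Proc.fn_map hf, Finset.disjoint_image hf]) ih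
  | com _ _ ih₁ ih₂ => exact .com ih₁ ih₂
  | close hy _ _ ih₁ ih₂ => exact .close (Proc.notMem_fn_map hf hy) ih₁ ih₂
  | rep _ ih => exact .rep ih
  | cong h₁ _ h₂ ih => exact .cong (h₁.map hf) ih (h₂.map hf)

/-- The second clause serves the `com` case: the received name is already free in the sender, so a
silent step acquires nothing. -/
theorem Step.fn_subset {P Q : Proc} {a : Act} (h : Step P a Q) :
    Q.fn ⊆ P.fn ∪ a.acquired ∧ ∀ x y, a = .out x y → y ∈ P.fn := by
  induction h with
  | out x y => simp [Proc.fn]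
  | inp x y hz =>
    refine ⟨fun v hv => ?_, by simp⟩
    have := Proc.fn_subst_subset _ _ _ hv
    simp only [Proc.fn, Act.acquired, Finset.mem_insert, Finset.mem_union,
      Finset.mem_singleton] at this ⊢
    tauto
  | opn hxy _ ih =>
    refine ⟨fun v hv => ?_, by simp⟩
    have := ih.1 hv
    simp only [Proc.fn, Act.acquired, Finset.mem_erase, Finset.mem_union,
      Finset.mem_singleton, Finset.notMem_empty] at this ⊢
    tauto
  | res hy _ ih =>
    refine ⟨fun v hv => ?_, fun u v e => ?_⟩
    · simp only [Proc.fn, Finset.mem_erase, Finset.mem_union] at hv ⊢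
      have := Finset.mem_union.1 (ih.1 hv.2)
      tauto
    · have := ih.2 u v e
      subst e
      simp only [Act.names, Finset.mem_insert, Finset.mem_singleton] at hy
      exact Finset.mem_erase.2 ⟨fun e => hy (.inr e.symm), this⟩
  | par Q hd _ ih =>
    refine ⟨fun v hv => ?_, fun u v e => Finset.mem_union_left _ (ih.2 u v e)⟩
    simp only [Proc.fn, Finset.mem_union] at hv ⊢
    have := fun h => Finset.mem_union.1 (@ih.1 v h)
    tauto
  | com _ _ ih₁ ih₂ =>
    refine ⟨fun v hv => ?_, by simp⟩
    have h₁ := @ih₁.1 v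
    have h₂ := @ih₂.1 v
    have h₃ := ih₂.2 _ _ rfl
    simp only [Proc.fn, Act.acquired, Finset.mem_union, Finset.mem_singleton,
      Finset.notMem_empty] at h₁ h₂ hv ⊢
    grind
  | close hy _ _ ih₁ ih₂ =>
    refine ⟨fun v hv => ?_, by simp⟩
    have h₁ := @ih₁.1 v
    have h₂ := @ih₂.1 v
    simp only [Proc.fn, Act.acquired, Finset.mem_union, Finset.mem_singleton, Finset.mem_erase,
      Finset.notMem_empty] at h₁ h₂ hv ⊢
    grind
  | rep _ ih => simpa [Proc.fn] using ih
  | cong h₁ _ h₂ ih => rwa [h₁.fn_eq, ← h₂.fn_eq]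

/-- The private name of a bound output can be chosen freely. -/
theorem Step.bout_rename {P R : Proc} {x y z : Name} (h : Step P (.bout x y) R) (hy : y ∉ P.fn)
    (hz : z ∉ P.fn) : ∃ x' R', Step P (.bout x' z) R' := by
  have h' := h.map (Equiv.swap y z).injective
  simp only [Act.map, Equiv.swap_apply_left] at h'
  refine ⟨_, _, .cong (.alpha ?_) h' (.alpha (.refl _))⟩
  -- Neither `y` nor `z` is free in `P`, so swapping them leaves `P` unchanged up to
  -- alpha-equivalence.
  have := AlphaEq.map_of_eqOn (f := _root_.id) (P := P) Function.injective_id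
    (Equiv.swap y z).injective fun v hv => (Equiv.swap_apply_of_ne_of_ne
      (fun e : v = y => hy (e ▸ hv)) fun e : v = z => hz (e ▸ hv)).symm
  rwa [Proc.map_id] at this

/-! ### The renaming generated by an automorphism -/

theorem Hypergraph.Aut.HasOneOrbit.isCycleOn {N X : Type} [Finite N] [Finite X]
    {H : Hypergraph N X} {σ : H.Aut} (h : σ.HasOneOrbit) : σ.nodes.IsCycleOn Set.univ := by
  refine ⟨Set.bijOn_univ.2 σ.nodes.bijective, fun a _ b _ => ?_⟩
  have hb : b ∈ σ.orbit a := by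
    rw [h.unique ⟨a, rfl⟩ ⟨b, rfl⟩]
    exact ⟨0, rfl⟩
  obtain ⟨j, hj⟩ := hb
  exact ⟨j, by simpa using hj⟩

section Rename

variable {k : ℕ}

theorem nodeName_injective : Function.Injective (nodeName (k := k)) := by
  intro i j h
  simpa [nodeName, Fin.ext_iff] using h

theorem nodeOf_nodeName (i : Fin k) : nodeOf k (nodeName i) = some i := by
  simp [nodeName, nodeOf]

theorem nodeOf_eq_some {x : Name} {i : Fin k} (h : nodeOf k x = some i) : x = nodeName i := by
  match x, h with
  | .num (n + 1), h =>
    simp only [nodeOf, Option.dite_none_right_eq_some, Option.some.injEq] at h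
    obtain ⟨_, rfl⟩ := h
    rfl

variable {P : Fin k → Proc} (σ : (netHypergraph P).Aut)

theorem renameName_nodeName (i : Fin k) :
    renameName σ (nodeName i) = nodeName (σ.nodes i) := by
  simp [renameName, nodeOf_nodeName]

theorem renameName_of_mem {x : Name} (hx : nodeOf k x = none) (h : x ∈ netArcs P) :
    renameName σ x = (σ.arcs ⟨x, h⟩).1 := by
  simp [renameName, hx, h]

theorem renameName_of_notMem {x : Name} (hx : nodeOf k x = none) (h : x ∉ netArcs P) :
    renameName σ x = x := by
  simp [renameName, hx, h]

theorem renameName_o : renameName σ .o = .o :=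
  renameName_of_notMem σ rfl (by simp [netArcs])

theorem mem_netArcs {x : Name} : x ∈ netArcs P ↔ x ≠ .o ∧ ∃ i, x ∈ (P i).fn := by
  simp [netArcs]

/-- A name that is neither an arc nor an identifier is the image of itself only. -/
theorem renameName_eq_iff {y : Name} (h : y ∉ netArcs P) (hy : nodeOf k y = none) (x : Name) :
    renameName σ x = y ↔ x = y := by
  refine ⟨fun e => ?_, fun e => by rw [e, renameName_of_notMem σ hy h]⟩
  cases hx : nodeOf k x with
  | some i =>
    rw [nodeOf_eq_some hx, renameName_nodeName] at e
    rw [← e, nodeOf_nodeName] at hy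
    cases hy
  | none =>
    by_cases hm : x ∈ netArcs P
    · rw [renameName_of_mem σ hx hm] at e
      exact absurd (e ▸ (σ.arcs ⟨x, hm⟩).2) h
    · rwa [renameName_of_notMem σ hx hm] at e

variable {σ}

theorem SymmetricWrt.occ_eq (h : SymmetricWrt P σ) (i : Fin k) :
    (P (σ.nodes i)).occ = (P i).occ.map (renameName σ) := by
  obtain ⟨Q, h₁, hQ, h₂⟩ := h i
  rw [← h₂.occ_eq, h₁.occ_eq,
    Proc.occ_map fun y hy => renameName_eq_iff σ (hQ y hy).1 (hQ y hy).2.2]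

theorem SymmetricWrt.occ_pow_eq (h : SymmetricWrt P σ) (m : ℕ) (i : Fin k) :
    (P ((σ.nodes ^ m) i)).occ = (P i).occ.map (renameName σ)^[m] := by
  induction m with
  | zero => simp
  | succ m ih =>
    rw [pow_succ', Equiv.Perm.mul_apply, h.occ_eq, ih, List.map_map, Function.iterate_succ']

/-! ### The order of the renaming. -/

theorem pow_card_apply {c : Equiv.Perm (Fin k)} (hc : c.IsCycleOn Set.univ) (i : Fin k) :
    (c ^ k) i = i := by
  have : c.IsCycleOn (Finset.univ : Finset (Fin k)) := by simpa using hc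
  simpa using this.pow_card_apply (Finset.mem_univ i)

theorem renameName_iterate_nodeName (m : ℕ) (i : Fin k) :
    (renameName σ)^[m] (nodeName i) = nodeName ((σ.nodes ^ m) i) := by
  induction m with
  | zero => rfl
  | succ m ih =>
    rw [Function.iterate_succ_apply', ih, renameName_nodeName, pow_succ', Equiv.Perm.mul_apply]

/-- After `k` steps the node is back, so the list of free occurrences of its component equals its
own image. Lists are compared position by position, hence every free name is fixed; equality of sets
would only give a permutation. Injectivity of `renameName` is a consequence, not an assumption. -/
theorem SymmetricWrt.renameName_iterate (h : SymmetricWrt P σ)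
    (hc : σ.nodes.IsCycleOn Set.univ) (x : Name) : (renameName σ)^[k] x = x := by
  cases hx : nodeOf k x with
  | some i => rw [nodeOf_eq_some hx, renameName_iterate_nodeName, pow_card_apply hc]
  | none =>
    by_cases hm : x ∈ netArcs P
    · obtain ⟨i, hi⟩ := (mem_netArcs.1 hm).2
      have := h.occ_pow_eq k i
      rw [pow_card_apply hc] at this
      exact List.map_inj_left.1 (this.symm.trans (List.map_id _).symm) x (Proc.mem_occ.2 hi)
    · exact Function.iterate_fixed (renameName_of_notMem σ hx hm) k

/-- In a symmetric network with one node, the automorphism is the identity. -/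
theorem SymmetricWrt.two_le (h : SymmetricWrt P σ) (horbit : σ.HasOneOrbit)
    (hid : σ ≠ .id _) : 2 ≤ k := by
  have hit := h.renameName_iterate horbit.isCycleOn
  rcases k with _ | _ | k
  · obtain ⟨_, ⟨n, _⟩, _⟩ := horbit
    exact n.elim0
  · refine absurd ?_ hid
    have harc : ∀ x (hx : x ∈ netArcs P), nodeOf 1 x = none → (σ.arcs ⟨x, hx⟩).1 = x :=
      fun x hx hn => (renameName_of_mem σ hn hx).symm.trans (hit x)
    have hnode : ∀ x y i j, nodeOf 1 x = some i → nodeOf 1 y = some j → x = y := by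
      intro x y i j hi hj
      rw [nodeOf_eq_some hi, nodeOf_eq_some hj, Subsingleton.elim i j]
    have harcs : σ.arcs = 1 := by
      ext ⟨x, hx⟩
      -- `renameName` treats an arc that is an identifier as a node, so invariance says nothing
      -- directly about such an arc. There is only one identifier: its image is either itself, or a
      -- non-identifier, which is fixed and so contradicts injectivity of the arc permutation.
      cases hn : nodeOf 1 x with
      | none => exact harc x hx hn
      | some i =>
        cases hn' : nodeOf 1 (σ.arcs ⟨x, hx⟩).1 with
        | none =>
          have := harc _ (σ.arcs ⟨x, hx⟩).2 hn'
          exact congrArg Subtype.val (σ.arcs.injective (Subtype.ext this))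
        | some j => exact hnode _ _ _ _ hn' hn
    have hnodes : σ.nodes = 1 := Equiv.ext fun i => Subsingleton.elim (α := Fin 1) _ _
    cases σ
    simp only at harcs hnodes
    subst harcs hnodes
    rfl
  · omega

end Rename

/-- A renaming of order dividing `k` that permutes the identifiers of the `k` nodes in one
cycle, together with infinitely many cycles of unused names, each with one name per node. -/
structure NetSymmetry (k : ℕ) where
  rename : Equiv.Perm Name
  nodes : Equiv.Perm (Fin k)
  spare : ℕ × Fin k ↪ Name
  cycle : nodes.IsCycleOn Set.univ
  rename_pow : rename ^ k = 1
  rename_o : rename .o = .o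
  rename_nodeName : ∀ i, rename (nodeName i) = nodeName (nodes i)
  rename_spare : ∀ q i, rename (spare (q, i)) = spare (q, nodes i)
  spare_ne_o : ∀ p, spare p ≠ .o
  nodeOf_spare : ∀ p, nodeOf k (spare p) = none

/-- The processes `Q i` are permuted by the symmetry. -/
def NetSymmetry.Preserves {k : ℕ} (s : NetSymmetry k) (Q : Fin k → Proc) : Prop :=
  ∀ i, AlphaEq ((Q i).map s.rename) (Q (s.nodes i))

/-- A permutation of finite order from a function with an identical iterate. -/
theorem exists_perm_of_iterate_eq {α : Type*} {f : α → α} {n : ℕ} (h : ∀ x, f^[n + 1] x = x) :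
    ∃ e : Equiv.Perm α, ⇑e = f ∧ e ^ (n + 1) = 1 := by
  refine ⟨⟨f, f^[n], fun x => h x, fun x => ?_⟩, rfl, ?_⟩
  · rw [← Function.iterate_succ_apply' f n x, h]
  · ext x
    rw [← Equiv.Perm.iterate_eq_pow]
    exact h x

theorem exists_bound_chan (B : Finset Name) : ∃ N, ∀ n, N ≤ n → Name.chan n ∉ B := by
  have hfin : {n | Name.chan n ∈ B}.Finite :=
    B.finite_toSet.preimage fun a _ b _ h => Name.chan.inj h
  obtain ⟨N, hN⟩ := hfin.bddAbove
  exact ⟨N + 1, fun n hn hmem => absurd (hN hmem) (by omega)⟩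

/-- Away from the spare names the permutation is `renameName`, so the given renamings of the
components still witness the symmetry. -/
theorem SymmetricWrt.exists_netSymmetry {k : ℕ} {P : Fin k → Proc} {σ : (netHypergraph P).Aut}
    (h : SymmetricWrt P σ) (hc : σ.nodes.IsCycleOn Set.univ) (hk : k ≠ 0) :
    ∃ s : NetSymmetry k, s.Preserves P := by
  have : NeZero k := ⟨hk⟩
  choose Q hPQ hbv hQP using h
  -- Channels from `N` on are neither arcs nor binders of the alpha-variants `Q i`; numbering them
  -- by quotient and remainder modulo `k` yields the spare cycles.
  obtain ⟨N, hN⟩ := exists_bound_chan (netArcs P ∪ Finset.univ.biUnion fun i => (Q i).bv)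
  simp only [Finset.mem_union, Finset.mem_biUnion, Finset.mem_univ, true_and, not_or,
    not_exists] at hN
  let spare : ℕ × Fin k ↪ Name :=
    ⟨fun p => .chan (N + (Nat.divModEquiv k).symm p), fun p p' e =>
      (Nat.divModEquiv k).symm.injective (Nat.add_left_cancel (Name.chan.inj e))⟩
  have hle : ∀ p, ∃ n, N ≤ n ∧ spare p = .chan n := fun p => ⟨_, Nat.le_add_right _ _, rfl⟩
  classical
  let f : Name → Name := fun x =>
    if hx : ∃ p, spare p = x then spare (hx.choose.1, σ.nodes hx.choose.2) else renameName σ x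
  have hf_spare : ∀ q i, f (spare (q, i)) = spare (q, σ.nodes i) := by
    intro q i
    have hx : ∃ p, spare p = spare (q, i) := ⟨_, rfl⟩
    have := spare.injective hx.choose_spec
    simp only [f, dif_pos hx, this]
  have hf_other : ∀ x, (¬ ∃ p, spare p = x) → f x = renameName σ x := fun x hx => dif_neg hx
  have hit : ∀ x, f^[k] x = x := by
    intro x
    by_cases hx : ∃ p, spare p = x
    · obtain ⟨⟨q, i⟩, rfl⟩ := hx
      have : ∀ m, f^[m] (spare (q, i)) = spare (q, (σ.nodes ^ m) i) := by
        intro m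
        induction m with
        | zero => rfl
        | succ m ih =>
          rw [Function.iterate_succ_apply', ih, hf_spare, pow_succ', Equiv.Perm.mul_apply]
      rw [this, pow_card_apply hc]
    · have : ∀ m, f^[m] x = (renameName σ)^[m] x ∧ ¬ ∃ p, spare p = (renameName σ)^[m] x := by
        intro m
        induction m with
        | zero => exact ⟨rfl, hx⟩
        | succ m ih =>
          rw [Function.iterate_succ_apply', Function.iterate_succ_apply', ih.1,
            hf_other _ ih.2]
          refine ⟨rfl, ?_⟩
          rintro ⟨p, hp⟩
          obtain ⟨n, hn, e⟩ := hle p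
          rw [e] at hp
          -- A spare name is the image under `renameName` of itself only, so the orbit of any other
          -- name never meets the spare names.
          have := (renameName_eq_iff σ (hN n hn).1 rfl _).1 hp.symm
          exact ih.2 ⟨p, e.trans this.symm⟩
      rw [(this k).1, SymmetricWrt.renameName_iterate (fun i => ⟨Q i, hPQ i, hbv i, hQP i⟩) hc]
  obtain ⟨l, rfl⟩ := Nat.exists_eq_succ_of_ne_zero hk
  obtain ⟨ρ, hρ, hpow⟩ := exists_perm_of_iterate_eq hit
  refine ⟨⟨ρ, σ.nodes, spare, hc, hpow, ?_, fun i => ?_, fun q i => ?_, fun p => ?_,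
    fun p => ?_⟩, fun i => ?_⟩
  · rw [hρ, hf_other _ (by rintro ⟨p, hp⟩; cases hp), renameName_o]
  · rw [hρ, hf_other _ (by rintro ⟨p, hp⟩; cases hp), renameName_nodeName]
  · rw [hρ, hf_spare]
  · exact fun e => by cases e
  · rfl
  · refine ((hPQ i).map ρ.injective).trans ?_
    change AlphaEq _ (P (σ.nodes i))
    rw [Proc.map_congr (g := renameName σ) (fun x hx => ?_) fun x hx => ?_]
    · exact hQP i
    · rw [hρ]
      refine hf_other _ ?_
      rintro ⟨p, hp⟩
      obtain ⟨n, hn, e⟩ := hle p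
      rw [← (hPQ i).fn_eq, ← hp, e] at hx
      exact (hN n hn).1 (mem_netArcs.2 ⟨by simp, i, hx⟩)
    · rw [hρ]
      refine hf_other _ ?_
      rintro ⟨p, hp⟩
      obtain ⟨n, hn, e⟩ := hle p
      rw [← hp, e] at hx
      exact (hN n hn).2 i hx

/-! ### Computations -/

section Computations

variable {k : ℕ} {P : Fin k → Proc}

namespace Computation

theorem Extends.refl (C : Computation P) : C.Extends C :=
  ⟨le_rfl, fun _ _ => rfl, fun _ _ => ⟨rfl, rfl⟩⟩

theorem Extends.contains {C C' : Computation P} (h : C.Extends C') {a : Act}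
    (ha : C.Contains a) : C'.Contains a := by
  obtain ⟨m, hm, e⟩ := ha
  exact ⟨m, hm.trans_le h.1, (h.2.2 m hm).1.trans e⟩

/-- A finite computation can be prolonged by a transition. -/
theorem exists_snoc (C : Computation P) {n : ℕ} (hn : C.length = n) {a : Act}
    {c : Fin k → Option Act} {S : NetState k} (h : NetStep (C.state n) a c S) :
    ∃ C' : Computation P, C.Extends C' ∧ C'.length = (n + 1 : ℕ) ∧ C'.state (n + 1) = S ∧
      C'.act n = a ∧ C'.contrib n = c := by
  refine ⟨⟨(n + 1 : ℕ), Function.update C.state (n + 1) S, Function.update C.act n a,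
    Function.update C.contrib n c, ?_, fun m hm => ?_⟩, ⟨?_, fun m hm => ?_, fun m hm => ?_⟩,
    rfl, by simp, by simp, by simp⟩
  · simpa [Function.update_apply] using C.init
  · have hm : m < n + 1 := Nat.cast_lt.1 hm
    rw [Function.update_of_ne (by omega)]
    rcases Nat.lt_succ_iff_lt_or_eq.1 hm with hm | rfl
    · rw [Function.update_of_ne (by omega), Function.update_of_ne (by omega),
        Function.update_of_ne (by omega)]
      exact C.step m (by rw [hn]; exact_mod_cast hm)
    · simpa using h
  · exact hn.trans_le (Nat.cast_le.2 n.le_succ)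
  · have hm : m ≤ n := by
      rw [hn] at hm
      exact_mod_cast hm
    exact Function.update_of_ne (by omega) _ _
  · have hm : m < n := by
      rw [hn] at hm
      exact_mod_cast hm
    exact ⟨Function.update_of_ne (by omega) _ _, Function.update_of_ne (by omega) _ _⟩

end Computation

/-- No component declares a leader. -/
def Undecided (c : Fin k → Option Act) : Prop :=
  ∀ i (n : Fin k), c i ≠ some (.out .o (nodeName n))

/-- The state `S` is reached by a finite computation that does not declare a leader. -/
def ReachesUndecided (P : Fin k → Proc) (S : NetState k) : Prop :=
  ∃ (C : Computation P) (n : ℕ), C.length = n ∧ C.state n = S ∧ ∀ m < n, Undecided (C.contrib m)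

theorem ReachesUndecided.init : ReachesUndecided P ⟨∅, P⟩ :=
  ⟨⟨0, fun _ => ⟨∅, P⟩, fun _ => .tau, fun _ _ => none, rfl, fun m hm => by simp at hm⟩, 0, rfl,
    rfl, fun m hm => by simp at hm⟩

theorem ReachesUndecided.step {S S' : NetState k} {a : Act} {c : Fin k → Option Act}
    (h : ReachesUndecided P S) (hs : NetStep S a c S') (hc : Undecided c) :
    ReachesUndecided P S' := by
  obtain ⟨C, n, hn, rfl, hu⟩ := h
  obtain ⟨C', hC, hl, hS, -, hc'⟩ := C.exists_snoc hn hs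
  refine ⟨C', n + 1, hl, hS, fun m hm => ?_⟩
  rcases Nat.lt_succ_iff_lt_or_eq.1 hm with hm | rfl
  · rw [(hC.2.2 m (by rw [hn]; exact_mod_cast hm)).2]
    exact hu m hm
  · rwa [hc']

/-- An electoral system cannot stop before a leader is declared. -/
theorem IsElectoral.exists_step (h : IsElectoral P) (hk : k ≠ 0) {S : NetState k}
    (hS : ReachesUndecided P S) : ∃ a c S', NetStep S a c S' := by
  obtain ⟨C, n, hn, rfl, hu⟩ := hS
  obtain ⟨C', hC, l, hl, -⟩ := h C
  obtain ⟨m, hm, e⟩ := hl ⟨0, Nat.pos_of_ne_zero hk⟩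
  -- The declaration lies beyond the undecided computation `C`, so `C'` is strictly longer and its
  -- transition number `n` leaves the last state of `C`.
  have hnm : n ≤ m := by
    by_contra! hlt
    rw [(hC.2.2 m (by rw [hn]; exact_mod_cast hlt)).2] at e
    exact hu m hlt _ _ e
  have hlt : (n : ℕ∞) < C'.length := lt_of_le_of_lt (by exact_mod_cast hnm) hm
  have := C'.step n hlt
  rw [hC.2.1 n hn.ge] at this
  exact ⟨_, _, _, this⟩

/-- A computation of an electoral system does not output two different names on `o`. -/
theorem IsElectoral.eq_of_contains (h : IsElectoral P) {C : Computation P} {x y : Name}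
    (hx : C.Contains (.out .o x)) (hy : C.Contains (.out .o y)) : x = y := by
  obtain ⟨C', hC, l, -, hl⟩ := h C
  -- The outputs of `C` persist in `C'`, which is an extension of itself and so obeys the uniqueness
  -- clause.
  have key : ∀ z, C.Contains (.out .o z) → z = nodeName l := fun z hz => by
    by_contra hne
    exact hl C' (.refl C') z hne (hC.contains hz)
  rw [key x hx, key y hy]

theorem IsElectoral.eq_of_steps (h : IsElectoral P) {S₁ S₂ S₃ : NetState k} {x y : Name}
    {c c' : Fin k → Option Act} (hS : ReachesUndecided P S₁) (h₁ : NetStep S₁ (.out .o x) c S₂)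
    (h₂ : NetStep S₂ (.out .o y) c' S₃) : x = y := by
  obtain ⟨C, n, hn, rfl, -⟩ := hS
  obtain ⟨C₁, -, hl₁, rfl, ha₁, -⟩ := C.exists_snoc hn h₁
  obtain ⟨C₂, hC, hl₂, -, ha₂, -⟩ := C₁.exists_snoc hl₁ h₂
  refine h.eq_of_contains (C := C₂) (hC.contains ⟨n, ?_, ha₁⟩) ⟨n + 1, ?_, ha₂⟩
  · rw [hl₁]
    exact_mod_cast n.lt_succ_self
  · rw [hl₂]
    exact_mod_cast (n + 1).lt_succ_self

/-- An electoral system has no infinite computation in which no leader is declared, in particular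
no invariant that can be maintained forever without declaring one. -/
theorem IsElectoral.not_invariant (h : IsElectoral P) (hk : k ≠ 0) (I : NetState k → Prop)
    (h₀ : I ⟨∅, P⟩)
    (hI : ∀ S, I S → ∃ a c S', NetStep S a c S' ∧ Undecided c ∧ I S') : False := by
  choose a c next hstep hc hnext using hI
  let st : ℕ → {S // I S} := fun m =>
    Nat.rec ⟨⟨∅, P⟩, h₀⟩ (fun _ S => ⟨next S.1 S.2, hnext S.1 S.2⟩) m
  let C : Computation P := ⟨⊤, fun m => (st m).1, fun m => a _ (st m).2, fun m => c _ (st m).2,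
    rfl, fun m _ => hstep _ (st m).2⟩
  obtain ⟨C', hC, l, hl, -⟩ := h C
  -- The length of `C` is `⊤`, so `C'` agrees with it at every index.
  obtain ⟨m, -, e⟩ := hl ⟨0, Nat.pos_of_ne_zero hk⟩
  rw [(hC.2.2 m (ENat.natCast_lt_top m)).2] at e
  exact hc _ (st m).2 _ _ e

/-- A component can act alone when no name is hidden. -/
theorem NetStep.solo {Q : Fin k → Proc} {i : Fin k} {a : Act} {R : Proc} (h : Step (Q i) a R)
    (ha : ∀ x y, a = .bout x y → NetState.IsFresh ⟨∅, Q⟩ y) :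
    NetStep ⟨∅, Q⟩ a (Function.update (fun _ => none) i (some a)) ⟨∅, Function.update Q i R⟩ := by
  cases a with
  | tau => exact .tau (S := ⟨∅, Q⟩) h
  | inp x y => exact .inp (S := ⟨∅, Q⟩) h (by simp) (by simp)
  | out x y => exact .out (S := ⟨∅, Q⟩) h (by simp) (by simp)
  | bout x y => exact .bout (S := ⟨∅, Q⟩) h (by simp) (ha x y rfl)

/-- When no name is hidden and some transition is possible, a component can act alone: if two
components communicate, the sender can as well send to the environment. -/
theorem NetStep.exists_solo {Q : Fin k → Proc} {a : Act} {c : Fin k → Option Act} {S : NetState k}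
    (h : NetStep ⟨∅, Q⟩ a c S) :
    ∃ j b R, Step (Q j) b R ∧ ∀ x y, b = .bout x y → y ∉ (Q j).fn := by
  cases h with
  | tau h => exact ⟨_, _, _, h, by simp⟩
  | inp h => exact ⟨_, _, _, h, by simp⟩
  | out h => exact ⟨_, _, _, h, by simp⟩
  | opn _ _ h => simp at h
  | @bout i x y _ h _ hf =>
    exact ⟨_, _, _, h, fun x' y' e => by cases e; exact hf.2.2.2 i⟩
  | com _ _ h => exact ⟨_, _, _, h, by simp⟩
  | @close i j x y _ _ _ hf _ h =>
    exact ⟨_, _, _, h, fun x' y' e => by cases e; exact hf.2.2.2 j⟩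

end Computations

/-! ### Symmetric rounds -/

namespace NetSymmetry

variable {k : ℕ} (s : NetSymmetry k)

theorem exists_pow_eq (j i : Fin k) : ∃ m < k, (s.nodes ^ m) j = i := by
  have : s.nodes.IsCycleOn (Finset.univ : Finset (Fin k)) := by simpa using s.cycle
  simpa using this.exists_pow_eq (Finset.mem_univ j) (Finset.mem_univ i)

/-- The number of steps from the node `j` to the node `i` along the cycle of nodes. -/
noncomputable def index (j i : Fin k) : ℕ :=
  (s.exists_pow_eq j i).choose

theorem index_lt (j i : Fin k) : s.index j i < k :=
  (s.exists_pow_eq j i).choose_spec.1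

theorem pow_index (j i : Fin k) : (s.nodes ^ s.index j i) j = i :=
  (s.exists_pow_eq j i).choose_spec.2

/-- Exponents taking `j` to the same node are congruent modulo `k`, and both are below `k`. -/
theorem index_pow (j : Fin k) {m : ℕ} (hm : m < k) : s.index j ((s.nodes ^ m) j) = m := by
  have : s.nodes.IsCycleOn (Finset.univ : Finset (Fin k)) := by simpa using s.cycle
  have h := (this.pow_apply_eq_pow_apply (Finset.mem_univ j)).1
    (s.pow_index j ((s.nodes ^ m) j))
  rw [Finset.card_univ, Fintype.card_fin] at h
  exact h.eq_of_lt_of_lt (s.index_lt _ _) hm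

theorem nodes_ne (hk : 2 ≤ k) (i : Fin k) : s.nodes i ≠ i := by
  have : Nontrivial (Fin k) := Fin.nontrivial_iff_two_le.2 hk
  exact s.cycle.apply_ne Set.nontrivial_univ (Set.mem_univ i)

theorem pow_rename_o (m : ℕ) : (s.rename ^ m) .o = .o := by
  induction m with
  | zero => rfl
  | succ m ih => rw [pow_succ', Equiv.Perm.mul_apply, ih, s.rename_o]

theorem pow_rename_nodeName (m : ℕ) (i : Fin k) :
    (s.rename ^ m) (nodeName i) = nodeName ((s.nodes ^ m) i) := by
  induction m with
  | zero => rfl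
  | succ m ih =>
    rw [pow_succ', Equiv.Perm.mul_apply, ih, s.rename_nodeName, pow_succ', Equiv.Perm.mul_apply]

theorem pow_rename_spare (m q : ℕ) (i : Fin k) :
    (s.rename ^ m) (s.spare (q, i)) = s.spare (q, (s.nodes ^ m) i) := by
  induction m with
  | zero => rfl
  | succ m ih =>
    rw [pow_succ', Equiv.Perm.mul_apply, ih, s.rename_spare, pow_succ', Equiv.Perm.mul_apply]

/-- A finite set meets only finitely many spare cycles. A whole cycle is needed, since each node
extrudes its own member. -/
theorem exists_spare_notMem (B : Finset Name) : ∃ q, ∀ i, s.spare (q, i) ∉ B := by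
  have hfin : (Prod.fst '' (s.spare ⁻¹' (B : Set Name))).Finite :=
    (B.finite_toSet.preimage s.spare.injective.injOn).image _
  obtain ⟨q, hq⟩ := hfin.infinite_compl.nonempty
  exact ⟨q, fun i hi => hq ⟨(q, i), hi, rfl⟩⟩

variable {s}

theorem Preserves.pow {Q : Fin k → Proc} (h : s.Preserves Q) (m : ℕ) (i : Fin k) :
    AlphaEq ((Q i).map ⇑(s.rename ^ m)) (Q ((s.nodes ^ m) i)) := by
  induction m with
  | zero =>
    have : ⇑(s.rename ^ 0) = _root_.id := rfl
    rw [this, Proc.map_id]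
    exact .refl _
  | succ m ih =>
    have := (ih.map s.rename.injective).trans (h ((s.nodes ^ m) i))
    rw [Proc.map_map] at this
    rwa [pow_succ', pow_succ']

theorem Preserves.step {Q : Fin k → Proc} (h : s.Preserves Q) {j : Fin k} {b : Act} {R : Proc}
    (hs : Step (Q j) b R) (m : ℕ) :
    Step (Q ((s.nodes ^ m) j)) (b.map ⇑(s.rename ^ m)) (R.map ⇑(s.rename ^ m)) :=
  .cong (.alpha (h.pow m j).symm) (hs.map (s.rename ^ m).injective) (.alpha (.refl _))

variable (s)

/-- The components after `m` nodes, starting with `j`, have followed the example of `j`, whose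
new state is `R`. -/
noncomputable def advance (Q : Fin k → Proc) (j : Fin k) (R : Proc) (m : ℕ) : Fin k → Proc :=
  fun i => if s.index j i < m then R.map ⇑(s.rename ^ s.index j i) else Q i

theorem advance_zero (Q : Fin k → Proc) (j : Fin k) (R : Proc) : s.advance Q j R 0 = Q := by
  funext i
  simp [advance]

theorem advance_apply_pow (Q : Fin k → Proc) (j : Fin k) (R : Proc) {m : ℕ} (hm : m < k) :
    s.advance Q j R m ((s.nodes ^ m) j) = Q ((s.nodes ^ m) j) := by
  simp [advance, s.index_pow j hm]

theorem update_advance (Q : Fin k → Proc) (j : Fin k) (R : Proc) {m : ℕ} (hm : m < k) :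
    Function.update (s.advance Q j R m) ((s.nodes ^ m) j) (R.map ⇑(s.rename ^ m)) =
      s.advance Q j R (m + 1) := by
  funext i
  by_cases hi : i = (s.nodes ^ m) j
  · subst hi
    simp [advance, s.index_pow j hm]
  · have : s.index j i ≠ m := fun e => hi (by rw [← e, s.pow_index])
    rw [Function.update_of_ne hi]
    have : s.index j i < m + 1 ↔ s.index j i < m := by omega
    simp only [advance, this]

/-- The node of index `t` carries the `t`-th renaming of `R`, and one more renaming gives the state
of the next node. At the last node the cycle closes because the `k`-th power of the renaming is the
identity. -/
theorem preserves_advance (Q : Fin k → Proc) (j : Fin k) (R : Proc) :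
    s.Preserves (s.advance Q j R k) := by
  intro i
  simp only [advance, s.index_lt, if_true]
  rw [Proc.map_map]
  have hi := s.pow_index j i
  have : ⇑s.rename ∘ ⇑(s.rename ^ s.index j i) = ⇑(s.rename ^ s.index j (s.nodes i)) := by
    rcases Nat.lt_or_eq_of_le (Nat.succ_le_of_lt (s.index_lt j i)) with hlt | heq
    · have := s.index_pow j hlt
      rw [Nat.succ_eq_add_one, pow_succ', Equiv.Perm.mul_apply, hi] at this
      rw [this, pow_succ']
      rfl
    · have h₁ : s.nodes i = (s.nodes ^ 0) j := by
        rw [pow_zero, Equiv.Perm.one_apply]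
        have := (congrArg (fun n => (s.nodes ^ n) j) heq).trans (pow_card_apply s.cycle j)
        simpa only [Nat.succ_eq_add_one, pow_succ', Equiv.Perm.mul_apply, hi] using this
      rw [h₁, s.index_pow j (lt_of_le_of_lt (Nat.zero_le _) (s.index_lt j i)), pow_zero,
        ← (congrArg (s.rename ^ ·) heq).trans s.rename_pow]
      exact congrArg DFunLike.coe (pow_succ' s.rename _).symm
  rw [this]
  exact .refl _

/-- The state occurs in a round that started in a symmetric state `Q`: the component `j` has a
transition, the remaining components have to follow its example. -/
def InRound (S : NetState k) : Prop :=
  ∃ Q j b R m, m < k ∧ s.Preserves Q ∧ Step (Q j) b R ∧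
    (∀ x y, b = .bout x y → ∃ q, y = s.spare (q, j) ∧ ∀ i i', s.spare (q, i) ∉ (Q i').fn) ∧
    (∀ n : Fin k, b ≠ .out .o (nodeName n)) ∧ S = ⟨∅, s.advance Q j R m⟩

variable {s}

/-- A round can start in a symmetric state. -/
theorem Preserves.inRound {P : Fin k → Proc} (hP : IsElectoral P) (hk : 2 ≤ k)
    {Q : Fin k → Proc} (h : s.Preserves Q) (hQ : ReachesUndecided P ⟨∅, Q⟩) :
    s.InRound ⟨∅, Q⟩ := by
  obtain ⟨_, _, _, hstep⟩ := hP.exists_step (by omega) hQ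
  obtain ⟨j, b, R, hb, hfresh⟩ := hstep.exists_solo
  have hne : ∀ n : Fin k, b ≠ .out .o (nodeName n) := by
    rintro n rfl
    have h₁ := NetStep.solo hb (by simp)
    -- The node after `j` is still in its old state, so it can name the image of `n` right after `j`
    -- names `n`.
    have h₂ := h.step hb 1
    rw [Act.map, s.pow_rename_o, s.pow_rename_nodeName, pow_one,
      ← Function.update_of_ne (s.nodes_ne hk j) R Q] at h₂
    have e := nodeName_injective (hP.eq_of_steps hQ h₁ (NetStep.solo h₂ (by simp)))
    exact s.nodes_ne hk n e.symm
  have hk₀ : 0 < k := by omega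
  by_cases hbout : ∃ x y, b = .bout x y
  · obtain ⟨x, y, rfl⟩ := hbout
    obtain ⟨q, hq⟩ := s.exists_spare_notMem (Finset.univ.biUnion fun i => (Q i).fn)
    simp only [Finset.mem_biUnion, Finset.mem_univ, true_and, not_exists] at hq
    obtain ⟨x', R', hb'⟩ := hb.bout_rename (hfresh x y rfl) (hq j j)
    exact ⟨Q, j, _, R', 0, hk₀, h, hb', fun _ _ e => ⟨q, by cases e; rfl, hq⟩, by simp,
      by rw [s.advance_zero]⟩
  · exact ⟨Q, j, b, R, 0, hk₀, h, hb, fun x y e => absurd ⟨x, y, e⟩ hbout, hne,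
      by rw [s.advance_zero]⟩

/-- The renaming fixes `o` and permutes the identifiers, so a declaration by an imitator pulls back
to one by the first node. -/
theorem undecided_update {b : Act} (hb : ∀ n : Fin k, b ≠ .out .o (nodeName n)) (m : ℕ)
    (i : Fin k) :
    Undecided (Function.update (fun _ => none) i (some (b.map ⇑(s.rename ^ m)))) := by
  intro i' n e
  rw [Function.update_apply] at e
  split_ifs at e
  have e := Option.some.inj e
  cases b with
  | out x y =>
    simp only [Act.map, Act.out.injEq] at e
    obtain ⟨hx, hy⟩ := e
    rw [← s.pow_rename_o m] at hx
    have : nodeName n = (s.rename ^ m) (nodeName ((s.nodes ^ m).symm n)) := by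
      rw [s.pow_rename_nodeName, Equiv.apply_symm_apply]
    rw [this] at hy
    exact hb _ (by rw [(s.rename ^ m).injective hx, (s.rename ^ m).injective hy])
  | _ => cases e

/-- The names chosen by different nodes in one round are different. -/
theorem isFresh_spare {Q : Fin k → Proc} {j : Fin k} {x : Name} {R : Proc} {q m : ℕ}
    (hm : m < k) (hb : Step (Q j) (.bout x (s.spare (q, j))) R)
    (hq : ∀ i i', s.spare (q, i) ∉ (Q i').fn) :
    NetState.IsFresh ⟨∅, s.advance Q j R m⟩ (s.spare (q, (s.nodes ^ m) j)) := by
  refine ⟨s.spare_ne_o _, s.nodeOf_spare _, by simp, fun i hi => ?_⟩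
  simp only [advance] at hi
  split_ifs at hi with hlt
  · set t := s.index j i with ht
    -- Undoing the `t`-th renaming reduces the claim to `R`, whose only new name is the spare name
    -- at `j`. A clash would force `m - t` to be zero modulo `k`, but `0 < m - t < k`.
    have e : s.spare (q, (s.nodes ^ m) j) =
        (s.rename ^ t) (s.spare (q, (s.nodes ^ (m - t)) j)) := by
      rw [s.pow_rename_spare, ← Equiv.Perm.mul_apply, ← pow_add, Nat.add_sub_cancel' hlt.le]
    rw [e, Proc.fn_map (s.rename ^ t).injective,
      (s.rename ^ t).injective.mem_finset_image] at hi
    rcases Finset.mem_union.1 (hb.fn_subset.1 hi) with hi | hi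
    · exact hq _ _ hi
    · have hj : (s.nodes ^ (m - t)) j = (s.nodes ^ 0) j :=
        (Prod.mk.inj (s.spare.injective (Finset.mem_singleton.1 hi))).2
      have h₁ := s.index_pow j (m := m - t) (by omega)
      rw [hj, s.index_pow j (by omega)] at h₁
      omega
  · exact hq _ _ hi

/-- A round can be continued, and is followed by another round. -/
theorem InRound.exists_step {P : Fin k → Proc} (hP : IsElectoral P) (hk : 2 ≤ k) {S : NetState k}
    (hS : ReachesUndecided P S) (h : s.InRound S) :
    ∃ a c S', NetStep S a c S' ∧ Undecided c ∧ ReachesUndecided P S' ∧ s.InRound S' := by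
  obtain ⟨Q, j, b, R, m, hm, hQ, hb, hfresh, hne, rfl⟩ := h
  have hstep : Step (s.advance Q j R m ((s.nodes ^ m) j)) (b.map ⇑(s.rename ^ m))
      (R.map ⇑(s.rename ^ m)) := by
    rw [s.advance_apply_pow Q j R hm]
    exact hQ.step hb m
  have hnet := NetStep.solo hstep fun x y e => by
    cases b with
    | bout x' y' =>
      obtain ⟨q, rfl, hq⟩ := hfresh x' y' rfl
      simp only [Act.map, Act.bout.injEq] at e
      rw [← e.2, s.pow_rename_spare]
      exact isFresh_spare hm hb hq
    | _ => cases e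
  rw [s.update_advance Q j R hm] at hnet
  have hu := undecided_update (s := s) hne m ((s.nodes ^ m) j)
  have hS' := hS.step hnet hu
  refine ⟨_, _, _, hnet, hu, hS', ?_⟩
  rcases Nat.lt_or_eq_of_le (Nat.succ_le_of_lt hm) with hlt | heq
  · exact ⟨Q, j, b, R, m + 1, hlt, hQ, hb, hfresh, hne, rfl⟩
  · rw [Nat.succ_eq_add_one] at heq
    rw [heq] at hS' ⊢
    exact (s.preserves_advance Q j R).inRound hP hk hS'

end NetSymmetry

end PiA

theorem mainTheorem1 (k : ℕ) (P : Fin k → PiA.Proc) (σ : (PiA.netHypergraph P).Aut)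
    (hid : σ ≠ .id _) (horbit : σ.HasOneOrbit) (hsym : PiA.SymmetricWrt P σ) :
    ¬ PiA.IsElectoral P := by
  intro hP
  have hk : 2 ≤ k := hsym.two_le horbit hid
  obtain ⟨s, hs⟩ := hsym.exists_netSymmetry horbit.isCycleOn (by omega)
  -- Reachability belongs to the invariant because being electoral constrains only states of
  -- computations of `P`.
  refine hP.not_invariant (by omega) (fun S => PiA.ReachesUndecided P S ∧ s.InRound S)
    ⟨.init, hs.inRound hP hk .init⟩ ?_
  rintro S ⟨h₁, h₂⟩
  exact h₂.exists_step hP hk h₁
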